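/- Let $X$ be a real super-reflexive Banach space, i.e. every Banach space finitely representable in $X$ is reflexive. Let $(r_k)_{k\ge1}$ denote the Rademacher functions, $r_k(t)=\operatorname{sign}\sin(2^k\pi t)$. For every $\varepsilon>0$ there is a least positive integer $\mathfrak Q_X(\varepsilon)$ such that, whenever $n\ge \mathfrak Q_X(\varepsilon)$ and $x_1,\dots,x_n\in X$ satisfy $\int_0^1\big\|\sum_{k=1}^n r_k(t)x_k\big\|\,dt\le 1$, one has $\frac1n\sum_{k=1}^n\|x_k\|\le\varepsilon$. Moreover, for every $\alpha>1$ the function $\phi_\alpha:[0,1)\to[0,\infty)$, $$\phi_\alpha(t)=|\log (1/t)|^{-\alpha}\,\mathfrak Q_X(t)^{-1}\quad(0<t<1),\qquad \phi_\alpha(0)=0,$$ is a generalized cotype of $X$: it is nonnegative and nondecreasing on $[0,1)$, and there are constants $a,b>0$ such that, whenever $x_1,\dots,x_n\in X$ satisfy $$\int_0^1\Big\|\sum_{k=1}^n r_k(t)x_k\Big\|\,dt\le a,$$ one has $\|x_k\|<1$ for all $k$ and $\sum_{k=1}^n\phi_\alpha(\|x_k\|)\le b$. -/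

import Mathlib

open scoped BigOperators

/-- A real normed space is reflexive if the canonical isometry into its bidual is onto. -/
def IsReflexiveSpace (Y : Type*) [NormedAddCommGroup Y] [NormedSpace ℝ Y] : Prop :=
  Function.Surjective (NormedSpace.inclusionInDoubleDual ℝ Y)

/-- `Y` is finitely representable in `X`: every finite-dimensional subspace of `Y` is, for every
`ε > 0`, `(1 + ε)`-isomorphic to a subspace of `X`. -/
def FinitelyRepresentable (Y X : Type*) [NormedAddCommGroup Y] [NormedSpace ℝ Y]
    [NormedAddCommGroup X] [NormedSpace ℝ X] : Prop :=
  ∀ F : Submodule ℝ Y, FiniteDimensional ℝ F → ∀ ε : ℝ, 0 < ε →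
    ∃ T : F →ₗ[ℝ] X, ∀ y : F, ‖y‖ ≤ ‖T y‖ ∧ ‖T y‖ ≤ (1 + ε) * ‖y‖

/-- `X` is super-reflexive: every Banach space finitely representable in `X` is reflexive.
The universe of `X` is large enough for `Y`: a non-reflexive Banach space has a separable
non-reflexive closed subspace, and a separable Banach space has a copy in every universe. -/
def SuperReflexive.{u} (X : Type u) [NormedAddCommGroup X] [NormedSpace ℝ X] : Prop :=
  ∀ (Y : Type u) [NormedAddCommGroup Y] [NormedSpace ℝ Y] [CompleteSpace Y],
    FinitelyRepresentable Y X → IsReflexiveSpace Y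

/-- The `k`-th Rademacher function `r_k(t) = sign (sin (2 ^ k π t))`, used for `k ≥ 1`. -/
noncomputable def rademacher (k : ℕ) (t : ℝ) : ℝ :=
  Real.sign (Real.sin (2 ^ k * Real.pi * t))

/-- The Rademacher average `∫₀¹ ‖∑ₖ r_k(t) x_k‖ dt` of `x_1, …, x_n`
(the vector `x_k` is `x (k - 1)`, as `Fin n` starts from zero). -/
noncomputable def rademacherAverage {X : Type*} [NormedAddCommGroup X] [NormedSpace ℝ X]
    {n : ℕ} (x : Fin n → X) : ℝ :=
  ∫ t in (0 : ℝ)..1, ‖∑ k : Fin n, rademacher ((k : ℕ) + 1) t • x k‖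

/-- `φ`, a real function considered only on the set `D`, is a generalized cotype of `X`: it is
nonnegative and nondecreasing on `D`, and there are `a, b > 0` such that whenever the Rademacher
average of `x_1, …, x_n` is at most `a`, all the norms `‖x_k‖` belong to the domain `D` of `φ`
and `∑ₖ φ(‖x_k‖) ≤ b`. -/
def IsGeneralizedCotypeOn (X : Type*) [NormedAddCommGroup X] [NormedSpace ℝ X]
    (D : Set ℝ) (φ : ℝ → ℝ) : Prop :=
  (∀ t ∈ D, 0 ≤ φ t) ∧ MonotoneOn φ D ∧
    ∃ a b : ℝ, 0 < a ∧ 0 < b ∧ ∀ (n : ℕ) (x : Fin n → X), rademacherAverage x ≤ a →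
      (∀ k, ‖x k‖ ∈ D) ∧ ∑ k, φ ‖x k‖ ≤ b

/-- The positive integers `N` such that `(1/n) ∑ₖ ‖x_k‖ ≤ ε` for all `n ≥ N` and all
`x_1, …, x_n` in `X` with Rademacher average at most `1`. -/
def admissibleLengths (X : Type*) [NormedAddCommGroup X] [NormedSpace ℝ X] (ε : ℝ) : Set ℕ :=
  {N | 1 ≤ N ∧ ∀ n : ℕ, N ≤ n → ∀ x : Fin n → X, rademacherAverage x ≤ 1 →
    (n : ℝ)⁻¹ * ∑ k, ‖x k‖ ≤ ε}

/-- `𝔔_X(ε)`, the least element of `admissibleLengths X ε` (that there is one, if `X` is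
super-reflexive and `ε > 0`, is part of the theorem and not assumed). -/
noncomputable def frakQ (X : Type*) [NormedAddCommGroup X] [NormedSpace ℝ X] (ε : ℝ) : ℕ :=
  sInf (admissibleLengths X ε)

/-- `φ_α(t) = |log (1/t)|^{-α} 𝔔_X(t)⁻¹` for `0 < t < 1`, with `φ_α(0) = 0`. -/
noncomputable def phiAlpha (X : Type*) [NormedAddCommGroup X] [NormedSpace ℝ X]
    (α : ℝ) (t : ℝ) : ℝ :=
  if t = 0 then 0 else |Real.log (1 / t)| ^ (-α) * ((frakQ X t : ℕ) : ℝ)⁻¹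

/-! Suppose that no length is admissible for some `ε`. Then there are arbitrarily long families with
sign average at most 1 and mean norm above `ε`. Their norms are at most 1, so many of the vectors
have norm above `ε / 2`. A Riesz product argument (`exists_bounded_signSums`) extracts any
prescribed number of these with all sign sums bounded by 4. An ultrapower of `X` glues such finite
families into one infinite sequence with the same bounds. The ultrapower is finitely representable
in `X` (`finitelyRepresentable_ultrapower`), hence reflexive. By Baire category
(`exists_norm_lt_of_bounded_signSums`), bounded sign sums in a reflexive space force terms of
arbitrarily small norm, a contradiction.

For the cotype, the vectors are sorted by dyadic size. Admissibility bounds the number of vectors in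
level `j` by `frakQ X (2⁻¹ ^ (j + 1))` (`card_lt_frakQ`). This cancels the factor `frakQ⁻¹` in
`phiAlpha`, so level `j` contributes at most `((j + 1) log 2) ^ (-α)`, which is summable as `α > 1`.
-/

open Finset Filter Topology MeasureTheory
open scoped BoundedContinuousFunction

/-! ### Walsh analysis on the group of sign vectors -/

/-- The Walsh function of a finite set `S`, on the group of sign vectors. -/
noncomputable def walsh {ι : Type*} (S : Finset ι) (ω : ι → ℤˣ) : ℝ :=
  ∏ i ∈ S, ((ω i : ℤ) : ℝ)

lemma cast_unit_sq (u : ℤˣ) : ((u : ℤ) : ℝ) * ((u : ℤ) : ℝ) = 1 := by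
  rcases Int.units_eq_one_or u with rfl | rfl <;> simp

lemma abs_cast_unit (u : ℤˣ) : |((u : ℤ) : ℝ)| = 1 := by
  rcases Int.units_eq_one_or u with rfl | rfl <;> simp

lemma walsh_sq {ι : Type*} (S : Finset ι) (ω : ι → ℤˣ) : walsh S ω * walsh S ω = 1 := by
  simp only [walsh, ← Finset.prod_mul_distrib, cast_unit_sq, Finset.prod_const_one]

section

variable {ι : Type*} [Fintype ι] [DecidableEq ι]

/-- Flipping a single sign in `S` preserves the uniform measure and negates the function. -/
lemma expect_walsh {S : Finset ι} (hS : S.Nonempty) : 𝔼 ω : ι → ℤˣ, walsh S ω = 0 := by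
  obtain ⟨i, hi⟩ := hS
  have key : 𝔼 ω : ι → ℤˣ, walsh S ω = 𝔼 ω : ι → ℤˣ, -walsh S ω := by
    refine Fintype.expect_equiv (Equiv.mulLeft (Pi.mulSingle i (-1 : ℤˣ))) _ _ fun ω => ?_
    simp only [walsh, Equiv.coe_mulLeft, Pi.mul_apply, Units.val_mul, Int.cast_mul,
      Finset.prod_mul_distrib]
    have h : ∏ j ∈ S, (((Pi.mulSingle i (-1 : ℤˣ) : ι → ℤˣ) j : ℤ) : ℝ) = -1 := by
      rw [Finset.prod_eq_single_of_mem i hi]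
      · simp
      · intro j _ hj
        simp [Pi.mulSingle_eq_of_ne hj]
    rw [h]
    ring
  rw [Finset.expect_neg_distrib] at key
  linarith

lemma expect_sign_mul_sign (i j : ι) :
    𝔼 ω : ι → ℤˣ, ((ω i : ℤ) : ℝ) * ((ω j : ℤ) : ℝ) = if i = j then 1 else 0 := by
  split_ifs with h
  · subst h
    simp [cast_unit_sq]
  · have := expect_walsh (S := {i, j}) (by simp)
    simpa [walsh, Finset.prod_pair h] using this

/-- Bessel's inequality for the coordinates on the group of sign vectors. -/
lemma sum_sq_expect_mul_sign_le (f : (ι → ℤˣ) → ℝ) (G : Finset ι) :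
    ∑ i ∈ G, (𝔼 ω : ι → ℤˣ, f ω * ((ω i : ℤ) : ℝ)) ^ 2 ≤ 𝔼 ω : ι → ℤˣ, f ω ^ 2 := by
  set a : ι → ℝ := fun i => 𝔼 ω : ι → ℤˣ, f ω * ((ω i : ℤ) : ℝ) with ha
  have h0 : 0 ≤ 𝔼 ω : ι → ℤˣ, (f ω - ∑ i ∈ G, a i * ((ω i : ℤ) : ℝ)) ^ 2 :=
    Finset.expect_nonneg fun _ _ => sq_nonneg _
  have h1 : 𝔼 ω : ι → ℤˣ, f ω * ∑ i ∈ G, a i * ((ω i : ℤ) : ℝ) = ∑ i ∈ G, a i ^ 2 := by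
    simp_rw [Finset.mul_sum]
    rw [Finset.expect_sum_comm]
    refine Finset.sum_congr rfl fun i _ => ?_
    rw [sq]
    nth_rw 3 [ha]
    rw [Finset.mul_expect]
    exact Finset.expect_congr rfl fun ω _ => by ring
  have h2 : 𝔼 ω : ι → ℤˣ, (∑ i ∈ G, a i * ((ω i : ℤ) : ℝ)) ^ 2 = ∑ i ∈ G, a i ^ 2 := by
    simp_rw [sq, Finset.sum_mul_sum]
    rw [Finset.expect_sum_comm]
    refine Finset.sum_congr rfl fun i hi => ?_
    rw [Finset.expect_sum_comm]
    have : ∀ j, 𝔼 ω : ι → ℤˣ, a i * ((ω i : ℤ) : ℝ) * (a j * ((ω j : ℤ) : ℝ))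
        = a i * a j * if i = j then 1 else 0 := by
      intro j
      rw [← expect_sign_mul_sign, Finset.mul_expect]
      exact Finset.expect_congr rfl fun ω _ => by ring
    simp [this, hi]
  have h3 : 𝔼 ω : ι → ℤˣ, (f ω - ∑ i ∈ G, a i * ((ω i : ℤ) : ℝ)) ^ 2
      = 𝔼 ω : ι → ℤˣ, f ω ^ 2 - 2 * (𝔼 ω : ι → ℤˣ, f ω * ∑ i ∈ G, a i * ((ω i : ℤ) : ℝ))
        + 𝔼 ω : ι → ℤˣ, (∑ i ∈ G, a i * ((ω i : ℤ) : ℝ)) ^ 2 := by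
    rw [Finset.mul_expect, ← Finset.expect_sub_distrib, ← Finset.expect_add_distrib]
    exact Finset.expect_congr rfl fun ω _ => by ring
  rw [h3, h1, h2] at h0
  linarith

end

/-- Any large set of coordinates contains a set of `d` coordinates on which a given function with
values in `[-1, 1]` has small Walsh coefficients. -/
lemma exists_small_walsh_coefficients (d : ℕ) : ∀ η : ℝ, 0 < η → ∃ K : ℕ,
    ∀ (n : ℕ) (f : (Fin n → ℤˣ) → ℝ), (∀ ω, |f ω| ≤ 1) → ∀ G : Finset (Fin n), K ≤ #G →
      ∃ J ⊆ G, #J = d ∧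
        ∑ S ∈ J.powerset, |𝔼 ω, f ω * walsh S ω| ≤ |𝔼 ω, f ω| + η := by
  induction d with
  | zero =>
    intro η hη
    refine ⟨0, fun n f _ G _ => ⟨∅, by simp, rfl, ?_⟩⟩
    simp [walsh, hη.le]
  | succ d ih =>
    intro η hη
    obtain ⟨K, hK⟩ := ih (η / 2) (by positivity)
    -- One factor `2 ^ d` comes from Cauchy–Schwarz over the subsets of `J`, the other from Bessel
    -- applied to each `f * walsh S`. In `K + d + M`, the summand `d` pays for removing `J` from
    -- `G`.
    obtain ⟨M, hM⟩ := exists_nat_gt ((2 : ℝ) ^ d * 2 ^ d / (η / 2) ^ 2)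
    refine ⟨K + d + M, fun n f hf G hG => ?_⟩
    obtain ⟨J, hJG, hJd, hJ⟩ := hK n f hf G (by omega)
    have hcard : M ≤ #(G \ J) := by
      have := Finset.le_card_sdiff J G
      omega
    -- The new coordinate `i` only adds the coefficients at `insert i S`; if these were large for
    -- every `i`, Bessel's inequality would fail for some `S`.
    obtain ⟨i, hi, hiη⟩ : ∃ i ∈ G \ J,
        ∑ S ∈ J.powerset, |𝔼 ω, f ω * walsh (insert i S) ω| ≤ η / 2 := by
      by_contra! hcon
      have h1 : ∀ i ∈ G \ J, (η / 2) ^ 2 ≤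
          (2 : ℝ) ^ d * ∑ S ∈ J.powerset, (𝔼 ω, f ω * walsh (insert i S) ω) ^ 2 := by
        intro i hi
        calc (η / 2) ^ 2 ≤ (∑ S ∈ J.powerset, |𝔼 ω, f ω * walsh (insert i S) ω|) ^ 2 := by
              have := (hcon i hi).le
              gcongr
          _ ≤ #J.powerset * ∑ S ∈ J.powerset, |𝔼 ω, f ω * walsh (insert i S) ω| ^ 2 :=
              sq_sum_le_card_mul_sum_sq
          _ = _ := by simp [Finset.card_powerset, hJd]
      have h2 : ∀ S ∈ J.powerset,
          ∑ i ∈ G \ J, (𝔼 ω, f ω * walsh (insert i S) ω) ^ 2 ≤ 1 := by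
        intro S hS
        calc _ = ∑ i ∈ G \ J, (𝔼 ω, f ω * walsh S ω * ((ω i : ℤ) : ℝ)) ^ 2 := by
              refine Finset.sum_congr rfl fun i hi => ?_
              have : i ∉ S := fun h =>
                (Finset.mem_sdiff.1 hi).2 (Finset.mem_powerset.1 hS h)
              simp only [walsh, Finset.prod_insert this]
              congr 1
              exact Finset.expect_congr rfl fun ω _ => by ring
          _ ≤ 𝔼 ω, (f ω * walsh S ω) ^ 2 :=
              sum_sq_expect_mul_sign_le (fun ω => f ω * walsh S ω) (G \ J)
          _ ≤ 1 := by
              refine Finset.expect_le Finset.univ_nonempty fun ω _ => ?_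
              have := walsh_sq S ω
              have h := hf ω
              rw [mul_pow, sq (walsh S ω), this, mul_one]
              exact (sq_le_one_iff_abs_le_one _).2 h
      have h3 : (#(G \ J) : ℝ) * (η / 2) ^ 2 ≤ (2 : ℝ) ^ d * 2 ^ d := by
        calc (#(G \ J) : ℝ) * (η / 2) ^ 2 = ∑ i ∈ G \ J, (η / 2) ^ 2 := by simp
          _ ≤ ∑ i ∈ G \ J,
              (2 : ℝ) ^ d * ∑ S ∈ J.powerset, (𝔼 ω, f ω * walsh (insert i S) ω) ^ 2 :=
              Finset.sum_le_sum h1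
          _ = (2 : ℝ) ^ d * ∑ S ∈ J.powerset,
              ∑ i ∈ G \ J, (𝔼 ω, f ω * walsh (insert i S) ω) ^ 2 := by
              rw [← Finset.mul_sum, Finset.sum_comm]
          _ ≤ (2 : ℝ) ^ d * ∑ S ∈ J.powerset, 1 := by
              gcongr with S hS
              exact h2 S hS
          _ = _ := by simp [Finset.card_powerset, hJd]
      rw [div_lt_iff₀ (by positivity)] at hM
      have : (M : ℝ) * (η / 2) ^ 2 ≤ #(G \ J) * (η / 2) ^ 2 := by
        gcongr
      linarith
    obtain ⟨hiG, hiJ⟩ := Finset.mem_sdiff.1 hi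
    refine ⟨insert i J, Finset.insert_subset hiG hJG, by simp [hiJ, hJd], ?_⟩
    rw [Finset.sum_powerset_insert hiJ]
    linarith

/-! ### Averages over signs -/

section

variable {X : Type*} [NormedAddCommGroup X] [NormedSpace ℝ X]

/-- The mean of `‖∑ᵢ ωᵢ xᵢ‖` over all choices `ω` of signs. -/
noncomputable def signAverage {ι : Type*} [Fintype ι] [DecidableEq ι] (x : ι → X) : ℝ :=
  𝔼 ω : ι → ℤˣ, ‖∑ i, ((ω i : ℤ) : ℝ) • x i‖

/-- The sign vector that agrees with `ω` on `J` and with `-ω` off `J`. -/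
def flipOff {ι : Type*} [DecidableEq ι] (J : Finset ι) : Equiv.Perm (ι → ℤˣ) :=
  Equiv.mulLeft fun i => if i ∈ J then 1 else -1

variable {ι : Type*} [Fintype ι] [DecidableEq ι]

lemma signSum_add_flipOff (J : Finset ι) (ω : ι → ℤˣ) (x : ι → X) :
    ∑ i, ((ω i : ℤ) : ℝ) • x i + ∑ i, ((flipOff J ω i : ℤ) : ℝ) • x i
      = (2 : ℝ) • ∑ i ∈ J, ((ω i : ℤ) : ℝ) • x i := by
  rw [← Finset.sum_add_distrib, Finset.smul_sum, ← Finset.sum_filter_add_sum_filter_not univ (· ∈ J),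
    Finset.filter_mem_eq_inter, Finset.univ_inter]
  rw [Finset.sum_eq_zero (s := univ.filter (· ∉ J)), add_zero]
  · refine Finset.sum_congr rfl fun i hi => ?_
    simp [flipOff, hi, two_smul]
  · intro i hi
    simp only [mem_filter, mem_univ, true_and] at hi
    simp [flipOff, hi]

lemma norm_signSum_le_of_flipOff {J : Finset ι} {ω : ι → ℤˣ} {x : ι → X} {C : ℝ}
    (h₁ : ‖∑ i, ((ω i : ℤ) : ℝ) • x i‖ ≤ C)
    (h₂ : ‖∑ i, ((flipOff J ω i : ℤ) : ℝ) • x i‖ ≤ C) :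
    ‖∑ i ∈ J, ((ω i : ℤ) : ℝ) • x i‖ ≤ C := by
  have h := norm_add_le (∑ i, ((ω i : ℤ) : ℝ) • x i) (∑ i, ((flipOff J ω i : ℤ) : ℝ) • x i)
  rw [signSum_add_flipOff, norm_smul, Real.norm_ofNat] at h
  linarith

/-- Leaving out some of the vectors does not increase the sign average. -/
lemma expect_norm_signSum_le (J : Finset ι) (x : ι → X) :
    𝔼 ω : ι → ℤˣ, ‖∑ i ∈ J, ((ω i : ℤ) : ℝ) • x i‖ ≤ signAverage x := by
  have h1 : 𝔼 ω : ι → ℤˣ, ‖∑ i, ((flipOff J ω i : ℤ) : ℝ) • x i‖ = signAverage x :=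
    Fintype.expect_equiv (flipOff J) _ _ fun ω => rfl
  have h2 : 𝔼 ω : ι → ℤˣ, ‖∑ i ∈ J, ((ω i : ℤ) : ℝ) • x i‖ ≤
      𝔼 ω : ι → ℤˣ, (‖∑ i, ((ω i : ℤ) : ℝ) • x i‖
        + ‖∑ i, ((flipOff J ω i : ℤ) : ℝ) • x i‖) / 2 := by
    refine Finset.expect_le_expect fun ω _ => ?_
    have h := norm_add_le (∑ i, ((ω i : ℤ) : ℝ) • x i) (∑ i, ((flipOff J ω i : ℤ) : ℝ) • x i)
    rw [signSum_add_flipOff, norm_smul, Real.norm_ofNat] at h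
    linarith
  rw [← Finset.expect_div, Finset.expect_add_distrib, h1] at h2
  change _ ≤ (signAverage x + signAverage x) / 2 at h2
  linarith

lemma norm_le_signAverage (x : ι → X) (i : ι) : ‖x i‖ ≤ signAverage x := by
  have := expect_norm_signSum_le {i} x
  simpa [norm_smul, abs_cast_unit] using this

lemma signAverage_smul (c : ℝ) (x : ι → X) :
    signAverage (fun i => c • x i) = |c| * signAverage x := by
  simp only [signAverage, Finset.mul_expect]
  refine Finset.expect_congr rfl fun ω _ => ?_
  simp_rw [smul_comm _ c]
  rw [← Finset.smul_sum, norm_smul, Real.norm_eq_abs]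

lemma signAverage_comp_equiv {κ : Type*} [Fintype κ] [DecidableEq κ] (e : κ ≃ ι) (x : ι → X) :
    signAverage (x ∘ e) = signAverage x := by
  refine Fintype.expect_equiv (e.arrowCongr (Equiv.refl ℤˣ)) _ _ fun ω => ?_
  rw [← e.sum_comp]
  simp

lemma signAverage_subtype_le (J : Finset ι) (x : ι → X) :
    signAverage (fun i : {i // i ∈ J} => x i) ≤ signAverage x := by
  refine le_of_eq_of_le ?_ (expect_norm_signSum_le J x)
  have h := Fintype.expect_equiv (Equiv.piEquivPiSubtypeProd (· ∈ J) fun _ => ℤˣ)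
    (fun ω : ι → ℤˣ => ‖∑ i ∈ J, ((ω i : ℤ) : ℝ) • x i‖)
    (fun p => ‖∑ i : {i // i ∈ J}, ((p.1 i : ℤ) : ℝ) • x i‖) (fun ω => by
      rw [← Finset.sum_coe_sort]
      rfl)
  rw [h, ← Finset.univ_product_univ, Finset.expect_product]
  simp [signAverage]

lemma signAverage_comp_embedding_le {κ : Type*} [Fintype κ] [DecidableEq κ] (e : κ ↪ ι)
    (x : ι → X) : signAverage (x ∘ e) ≤ signAverage x := by
  have h := signAverage_subtype_le (univ.map e) x
  let e' : κ ≃ {i // i ∈ univ.map e} :=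
    (Equiv.ofInjective e e.injective).trans (Equiv.subtypeEquivRight (by simp))
  rw [← signAverage_comp_equiv e'] at h
  exact h

end

/-! ### Extraction of bounded sign sums by Riesz products -/

/-- Among many vectors with sign average at most `1` there are `d` ones all of whose sign sums
have norm at most `4`. -/
lemma exists_bounded_signSums (d : ℕ) : ∃ K : ℕ,
    ∀ {X : Type*} [NormedAddCommGroup X] [NormedSpace ℝ X] (n : ℕ) (x : Fin n → X),
      signAverage x ≤ 1 → ∀ G : Finset (Fin n), K ≤ #G →
      ∃ J ⊆ G, #J = d ∧ ∀ θ : Fin n → ℤˣ, ‖∑ i ∈ J, ((θ i : ℤ) : ℝ) • x i‖ ≤ 4 := by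
  classical
  obtain ⟨K, hK⟩ := exists_small_walsh_coefficients d (1 / 8) (by norm_num)
  refine ⟨K, fun {X} _ _ n x hx G hG => ?_⟩
  let f : (Fin n → ℤˣ) → ℝ := fun ω => if ‖∑ i, ((ω i : ℤ) : ℝ) • x i‖ ≤ 4 then 1 else 0
  have hf0 : ∀ ω, 0 ≤ f ω := fun ω => by simp only [f]; split_ifs <;> norm_num
  have hf1 : ∀ ω, f ω ≤ 1 := fun ω => by simp only [f]; split_ifs <;> norm_num
  obtain ⟨J, hJG, hJd, hJ⟩ := hK n f (fun ω => abs_le.2 ⟨by linarith [hf0 ω], hf1 ω⟩) G hG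
  refine ⟨J, hJG, hJd, fun θ => ?_⟩
  -- Markov's inequality at height 4.
  have hmean : 3 / 4 ≤ 𝔼 ω, f ω := by
    have : 𝔼 ω : Fin n → ℤˣ, (1 - f ω) ≤ 𝔼 ω : Fin n → ℤˣ, ‖∑ i, ((ω i : ℤ) : ℝ) • x i‖ / 4 := by
      refine Finset.expect_le_expect fun ω _ => ?_
      simp only [f]
      split_ifs with h
      · simp only [sub_self]; positivity
      · push Not at h; linarith
    rw [Finset.expect_sub_distrib, ← Finset.expect_div] at this
    simp only [Fintype.expect_const] at this
    change _ ≤ signAverage x / 4 at this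
    linarith
  -- This Riesz product is the density of the uniform measure conditioned on `ω = θ` on `J`.
  let R : (Fin n → ℤˣ) → ℝ := fun ω => ∏ i ∈ J, (1 + ((θ i : ℤ) : ℝ) * ((ω i : ℤ) : ℝ))
  have hR : ∀ g : (Fin n → ℤˣ) → ℝ,
      𝔼 ω, g ω * R ω = ∑ S ∈ J.powerset, walsh S θ * 𝔼 ω, g ω * walsh S ω := by
    intro g
    simp only [R, Finset.prod_one_add, Finset.mul_sum, Finset.prod_mul_distrib]
    rw [Finset.expect_sum_comm]
    refine Finset.sum_congr rfl fun S _ => ?_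
    rw [Finset.mul_expect]
    refine Finset.expect_congr rfl fun ω _ => ?_
    simp only [walsh]
    ring
  have hR1 : 𝔼 ω, R ω = 1 := by
    have := hR fun _ => 1
    simp only [one_mul] at this
    rw [this, Finset.sum_eq_single_of_mem ∅ (by simp)]
    · simp [walsh]
    · intro S _ hS
      rw [expect_walsh (Finset.nonempty_iff_ne_empty.2 hS), mul_zero]
  -- The nonempty Walsh terms total at most `1 / 8`, so the conditional probability is at least `3 /
  -- 4 - 1 / 8`.
  have hRf : 1 / 2 < 𝔼 ω, f ω * R ω := by
    have habs : ∀ S : Finset (Fin n), |walsh S θ| = 1 := fun S => by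
      simp [walsh, Finset.abs_prod, abs_cast_unit]
    rw [hR, ← Finset.add_sum_erase _ _ (Finset.empty_mem_powerset J)]
    rw [← Finset.add_sum_erase _ _ (Finset.empty_mem_powerset J)] at hJ
    have h1 : -∑ S ∈ J.powerset.erase ∅, |𝔼 ω, f ω * walsh S ω| ≤
        ∑ S ∈ J.powerset.erase ∅, walsh S θ * 𝔼 ω, f ω * walsh S ω := by
      rw [← Finset.sum_neg_distrib]
      refine Finset.sum_le_sum fun S _ => ?_
      have := neg_abs_le (walsh S θ * 𝔼 ω, f ω * walsh S ω)
      rwa [abs_mul, habs, one_mul] at this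
    simp only [walsh, Finset.prod_empty, mul_one, one_mul] at hJ h1 ⊢
    linarith
  have hflip : 𝔼 ω, f (flipOff J ω) * R ω = 𝔼 ω, f ω * R ω := by
    refine Fintype.expect_equiv (flipOff J) _ _ fun ω => ?_
    congr 1
    refine Finset.prod_congr rfl fun i hi => ?_
    simp [flipOff, hi]
  -- Two events of conditional probability above `1 / 2` must meet: some `ω` extending `θ` is good
  -- together with its flip off `J`.
  obtain ⟨ω, -, hω⟩ : ∃ ω ∈ (univ : Finset (Fin n → ℤˣ)),
      0 < (f ω + f (flipOff J ω) - 1) * R ω := by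
    by_contra! hcon
    have := Finset.expect_le_expect hcon
    simp only [add_mul, sub_mul, one_mul] at this
    rw [Finset.expect_sub_distrib, Finset.expect_add_distrib, hflip, hR1] at this
    simp only [Fintype.expect_const] at this
    linarith
  have hθ : ∀ i ∈ J, ω i = θ i := by
    intro i hi
    have hne := Finset.prod_ne_zero_iff.1 (right_ne_zero_of_mul hω.ne') i hi
    rcases Int.units_eq_one_or (ω i) with h | h <;>
      rcases Int.units_eq_one_or (θ i) with h' | h' <;> simp_all
  have hRω : 0 ≤ R ω := by
    refine Finset.prod_nonneg fun i hi => ?_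
    rw [hθ i hi, cast_unit_sq]
    norm_num
  have hpos : 0 < f ω + f (flipOff J ω) - 1 := pos_of_mul_pos_left hω hRω
  have hA : ∀ ω', 0 < f ω' → ‖∑ i, ((ω' i : ℤ) : ℝ) • x i‖ ≤ 4 := by
    intro ω' h
    by_contra hcon
    simp [f, hcon] at h
  rw [Finset.sum_congr rfl fun i hi => by rw [← hθ i hi]]
  exact norm_signSum_le_of_flipOff (hA _ (by linarith [hf1 (flipOff J ω)]))
    (hA _ (by linarith [hf1 ω]))

/-! ### Rademacher functions as independent signs -/

lemma measurable_rademacher (k : ℕ) : Measurable (rademacher k) := by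
  have : Measurable Real.sign :=
    Measurable.ite measurableSet_Iio measurable_const
      (Measurable.ite measurableSet_Ioi measurable_const measurable_const)
  unfold rademacher
  fun_prop

lemma abs_rademacher_le (k : ℕ) (t : ℝ) : |rademacher k t| ≤ 1 := by
  rcases Real.sign_apply_eq (Real.sin (2 ^ k * Real.pi * t)) with h | h | h <;>
    simp [rademacher, h]

lemma rademacher_succ (k : ℕ) (t : ℝ) : rademacher (k + 1) t = rademacher k (2 * t) := by
  simp only [rademacher]
  congr 2
  ring

lemma rademacher_succ_sub_one (k : ℕ) (t : ℝ) :
    rademacher (k + 1) (t - 1) = rademacher (k + 1) t := by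
  simp only [rademacher]
  have : (2 : ℝ) ^ (k + 1) * Real.pi * (t - 1)
      = 2 ^ (k + 1) * Real.pi * t - ((2 ^ k : ℕ) : ℝ) * (2 * Real.pi) := by
    push_cast
    ring
  rw [this, Real.sin_sub_nat_mul_two_pi]

lemma rademacher_one_of_lt_half {t : ℝ} (h0 : 0 < t) (h1 : t < 1 / 2) : rademacher 1 t = 1 := by
  refine Real.sign_of_pos (Real.sin_pos_of_pos_of_lt_pi ?_ ?_)
  · positivity
  · nlinarith [Real.pi_pos]

lemma rademacher_one_of_half_lt {t : ℝ} (h0 : 1 / 2 < t) (h1 : t < 1) : rademacher 1 t = -1 := by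
  refine Real.sign_of_neg ?_
  have := Real.sin_pos_of_pos_of_lt_pi (x := 2 ^ 1 * Real.pi * t - Real.pi)
    (by nlinarith [Real.pi_pos]) (by nlinarith [Real.pi_pos])
  rw [Real.sin_sub_pi] at this
  linarith

lemma expect_units (f : ℤˣ → ℝ) : 𝔼 u, f u = (f 1 + f (-1)) / 2 := by
  rw [Fintype.expect_eq_sum_div_card, UnitsInt.univ, Finset.sum_pair (by decide)]
  simp

lemma expect_fin_succ {n : ℕ} (f : (Fin (n + 1) → ℤˣ) → ℝ) :
    𝔼 ω, f ω = (𝔼 ω : Fin n → ℤˣ, f (Fin.cons 1 ω) + 𝔼 ω : Fin n → ℤˣ, f (Fin.cons (-1) ω)) / 2 := by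
  rw [← expect_units fun u => 𝔼 ω : Fin n → ℤˣ, f (Fin.cons u ω),
    ← Finset.expect_product' (f := fun u (ω : Fin n → ℤˣ) => f (Fin.cons u ω)),
    Finset.univ_product_univ]
  exact (Fintype.expect_equiv (Fin.consEquiv fun _ => ℤˣ) _ _ fun _ => rfl).symm

lemma intervalIntegrable_comp_rademacher {n : ℕ} {g : (Fin n → ℝ) → ℝ} (hg : Continuous g)
    (r : Fin n → ℕ) (a b : ℝ) :
    IntervalIntegrable (fun t => g fun k => rademacher (r k) t) volume a b := by
  have hm : Measurable fun t => g fun k => rademacher (r k) t :=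
    hg.measurable.comp (measurable_pi_lambda _ fun k => measurable_rademacher _)
  obtain ⟨C, hC⟩ := (isCompact_closedBall (0 : Fin n → ℝ) 1).exists_bound_of_continuousOn
    hg.continuousOn
  refine (intervalIntegrable_const (c := C)).mono_fun hm.aestronglyMeasurable ?_
  refine Filter.Eventually.of_forall fun t => ?_
  refine (hC _ ?_).trans (le_abs_self C)
  rw [mem_closedBall_zero_iff, pi_norm_le_iff_of_nonneg zero_le_one]
  exact fun k => abs_rademacher_le _ _

/-- The first `n` Rademacher functions are independent fair signs. -/
lemma integral_comp_rademacher : ∀ {n : ℕ} {g : (Fin n → ℝ) → ℝ}, Continuous g →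
    ∫ t in (0 : ℝ)..1, g (fun k => rademacher ((k : ℕ) + 1) t)
      = 𝔼 ω : Fin n → ℤˣ, g fun k => ((ω k : ℤ) : ℝ) := by
  intro n
  induction n with
  | zero =>
    intro g _
    have h : ∀ t : ℝ, (fun k : Fin 0 => rademacher ((k : ℕ) + 1) t) = 0 :=
      fun t => Subsingleton.elim _ _
    have h' : ∀ ω : Fin 0 → ℤˣ, (fun k => ((ω k : ℤ) : ℝ)) = 0 :=
      fun ω => Subsingleton.elim _ _
    simp [h, h']
  | succ n ih =>
    intro g hg
    have hcons : ∀ c : ℝ, Continuous fun v : Fin n → ℝ => g (Fin.cons c v) := fun c =>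
      hg.comp (Continuous.finCons continuous_const continuous_id)
    -- On each half of the interval the first Rademacher function is constant almost everywhere, and
    -- the substitution `2 * t` or `2 * t - 1` lowers the other indices by one.
    have h1 : ∫ t in (0 : ℝ)..(1 / 2), g (fun k => rademacher ((k : ℕ) + 1) t)
        = (𝔼 ω : Fin n → ℤˣ, g (Fin.cons 1 fun k => ((ω k : ℤ) : ℝ))) / 2 := by
      rw [← ih (hcons 1)]
      have h := intervalIntegral.integral_comp_mul_left (a := 0) (b := 1 / 2)
        (fun t => g (Fin.cons 1 fun k : Fin n => rademacher ((k : ℕ) + 1) t)) (two_ne_zero (α := ℝ))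
      norm_num at h
      refine Eq.trans ?_ (h.trans (by ring))
      refine intervalIntegral.integral_congr_ae ?_
      have hne : ∀ᵐ t : ℝ, t ≠ 1 / 2 := by simp [ae_iff]
      filter_upwards [hne] with t ht hmem
      rw [Set.uIoc_of_le (by norm_num)] at hmem
      congr 1
      refine funext fun k => Fin.cases ?_ (fun k => ?_) k
      · simpa using rademacher_one_of_lt_half hmem.1 (lt_of_le_of_ne hmem.2 ht)
      · simpa using rademacher_succ _ _
    have h2 : ∫ t in (1 / 2 : ℝ)..1, g (fun k => rademacher ((k : ℕ) + 1) t)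
        = (𝔼 ω : Fin n → ℤˣ, g (Fin.cons (-1) fun k => ((ω k : ℤ) : ℝ))) / 2 := by
      rw [← ih (hcons (-1))]
      have h := intervalIntegral.integral_comp_mul_sub (a := 1 / 2) (b := 1)
        (fun t => g (Fin.cons (-1) fun k : Fin n => rademacher ((k : ℕ) + 1) t))
        (two_ne_zero (α := ℝ)) 1
      norm_num at h
      refine Eq.trans ?_ (h.trans (by ring))
      refine intervalIntegral.integral_congr_ae ?_
      have hne : ∀ᵐ t : ℝ, t ≠ 1 := by simp [ae_iff]
      filter_upwards [hne] with t ht hmem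
      rw [Set.uIoc_of_le (by norm_num)] at hmem
      congr 1
      refine funext fun k => Fin.cases ?_ (fun k => ?_) k
      · simpa using rademacher_one_of_half_lt hmem.1 (lt_of_le_of_ne hmem.2 ht)
      · simp only [Fin.val_succ, Fin.cons_succ]
        rw [rademacher_succ, ← rademacher_succ_sub_one]
    rw [← intervalIntegral.integral_add_adjacent_intervals
      (intervalIntegrable_comp_rademacher hg _ 0 (1 / 2))
      (intervalIntegrable_comp_rademacher hg _ (1 / 2) 1), h1, h2, expect_fin_succ, ← add_div]
    have hc : ∀ (u : ℤˣ) (ω : Fin n → ℤˣ), (fun k => (((Fin.cons u ω : Fin (n + 1) → ℤˣ) k : ℤ) : ℝ))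
        = Fin.cons ((u : ℤ) : ℝ) fun k => ((ω k : ℤ) : ℝ) := fun u ω =>
      funext fun k => Fin.cases (by simp) (fun k => by simp) k
    simp [hc]

lemma rademacherAverage_eq_signAverage {X : Type*} [NormedAddCommGroup X] [NormedSpace ℝ X]
    {n : ℕ} (x : Fin n → X) : rademacherAverage x = signAverage x :=
  integral_comp_rademacher (g := fun c => ‖∑ k, c k • x k‖) (by fun_prop)

/-! ### The ultrapower and its finite representability -/

lemma exists_tendsto_norm_ultra {X : Type*} [NormedAddCommGroup X] (f : ℕ →ᵇ X) :
    ∃ l : ℝ, Tendsto (fun n => ‖f n‖) (hyperfilter ℕ : Filter ℕ) (𝓝 l) := by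
  have h : IsCompact (Set.Icc (0 : ℝ) ‖f‖) := isCompact_Icc
  obtain ⟨l, -, hl⟩ := h.ultrafilter_le_nhds ((hyperfilter ℕ).map fun n => ‖f n‖) (by
    rw [le_principal_iff, Ultrafilter.mem_coe, Ultrafilter.mem_map]
    exact Filter.univ_mem' fun n => ⟨norm_nonneg _, f.norm_coe_le_norm n⟩)
  exact ⟨l, hl⟩

section

variable (X : Type*) [NormedAddCommGroup X] [NormedSpace ℝ X]

/-- The bounded sequences that tend to zero along a fixed free ultrafilter on `ℕ`. -/
def ultraNull : Submodule ℝ (ℕ →ᵇ X) where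
  carrier := {f | Tendsto f (hyperfilter ℕ : Filter ℕ) (𝓝 0)}
  add_mem' := fun {f g} hf hg => by
    simpa [Pi.add_def] using Tendsto.add hf hg
  zero_mem' := tendsto_const_nhds
  smul_mem' := fun c f hf => by simpa using Tendsto.const_smul hf c

lemma mem_ultraNull {f : ℕ →ᵇ X} :
    f ∈ ultraNull X ↔ Tendsto f (hyperfilter ℕ : Filter ℕ) (𝓝 0) := Iff.rfl

instance isClosed_ultraNull : IsClosed (ultraNull X : Set (ℕ →ᵇ X)) := by
  refine isClosed_of_closure_subset fun f hf => ?_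
  refine Metric.tendsto_nhds.2 fun ε hε => ?_
  obtain ⟨g, hg, hfg⟩ := Metric.mem_closure_iff.1 hf (ε / 2) (by positivity)
  filter_upwards [Metric.tendsto_nhds.1 hg (ε / 2) (by positivity)] with n hn
  have := dist_triangle (f n) (g n) 0
  have := BoundedContinuousFunction.dist_coe_le_dist (f := f) (g := g) n
  linarith

/-- The ultrapower of `X` along a free ultrafilter on `ℕ`. -/
abbrev Ultrapower := (ℕ →ᵇ X) ⧸ ultraNull X

variable {X}

/-- The norm of the ultrapower is the limit of the norms of the terms. -/
lemma tendsto_norm_ultra (f : ℕ →ᵇ X) :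
    Tendsto (fun n => ‖f n‖) (hyperfilter ℕ : Filter ℕ)
      (𝓝 ‖(Submodule.Quotient.mk f : Ultrapower X)‖) := by
  classical
  obtain ⟨l, hl⟩ := exists_tendsto_norm_ultra f
  suffices h : ‖(Submodule.Quotient.mk f : Ultrapower X)‖ = l by rwa [h]
  refine le_antisymm (le_of_forall_pos_le_add fun ε hε => ?_)
    (le_of_forall_pos_le_add fun ε hε => ?_)
  · have hev : ∀ᶠ n in (hyperfilter ℕ : Filter ℕ), ‖f n‖ < l + ε :=
      hl.eventually (gt_mem_nhds (by linarith))
    have hl0 : 0 ≤ l := ge_of_tendsto' hl fun n => norm_nonneg _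
    -- Truncation changes `f` only off a set of the ultrafilter, so the class stays the same while
    -- the sup norm drops to at most `l + ε`.
    let g : ℕ →ᵇ X := BoundedContinuousFunction.ofNormedAddCommGroupDiscrete
      (fun n => if ‖f n‖ < l + ε then f n else 0) (l + ε) (fun n => by
        split_ifs with h
        · exact h.le
        · simpa using by linarith)
    have hgn : ∀ n, g n = if ‖f n‖ < l + ε then f n else 0 := fun n => rfl
    have hfg : (Submodule.Quotient.mk f : Ultrapower X) = Submodule.Quotient.mk g := by
      rw [Submodule.Quotient.eq, mem_ultraNull]
      refine tendsto_const_nhds.congr' ?_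
      filter_upwards [hev] with n hn
      simp [hgn, hn]
    rw [hfg]
    refine (Submodule.Quotient.norm_mk_le _ g).trans ?_
    refine (BoundedContinuousFunction.norm_le (by linarith)).2 fun n => ?_
    rw [hgn]
    split_ifs with h
    · exact h.le
    · simpa using by linarith
  · obtain ⟨g, hg, hgn⟩ := Submodule.Quotient.norm_mk_lt
      (Submodule.Quotient.mk f : Ultrapower X) hε
    rw [Submodule.Quotient.eq, mem_ultraNull] at hg
    have h1 : Tendsto (fun n => ‖f n‖ - ‖(g - f) n‖) (hyperfilter ℕ : Filter ℕ) (𝓝 (l - 0)) := by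
      refine hl.sub ?_
      simpa using hg.norm
    rw [sub_zero] at h1
    refine le_of_tendsto' h1 fun n => ?_
    have h2 := norm_sub_norm_le (f n) (f n - g n)
    have h3 := g.norm_coe_le_norm n
    rw [sub_sub_cancel] at h2
    rw [BoundedContinuousFunction.sub_apply, norm_sub_rev]
    linarith

/-- Maps that are uniformly Lipschitz and asymptotically norm preserving are, on a
finite-dimensional space, asymptotically almost isometric. -/
lemma eventually_almost_isometric {F : Type*} [NormedAddCommGroup F] [NormedSpace ℝ F]
    [FiniteDimensional ℝ F] {l : Filter ℕ} (T : ℕ → F →ₗ[ℝ] X) {C : ℝ} (hC : 0 < C)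
    (hT : ∀ n y, ‖T n y‖ ≤ C * ‖y‖) (hlim : ∀ y, Tendsto (fun n => ‖T n y‖) l (𝓝 ‖y‖))
    {η : ℝ} (hη : 0 < η) : ∀ᶠ n in l, ∀ y, |‖T n y‖ - ‖y‖| ≤ η * ‖y‖ := by
  -- Moving to a net point costs at most `(C + 1)` times this radius, that is `η / 2`.
  have hr : 0 < η / (2 * (C + 1)) := by positivity
  obtain ⟨t, -, htf, ht⟩ := (isCompact_sphere (0 : F) 1).finite_cover_balls hr
  have hev : ∀ᶠ n in l, ∀ z ∈ t, |‖T n z‖ - ‖z‖| < η / 2 := by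
    rw [eventually_all_finite htf]
    intro z _
    exact Metric.tendsto_nhds.1 (hlim z) (η / 2) (by positivity)
  filter_upwards [hev] with n hn
  have hsphere : ∀ y : F, ‖y‖ = 1 → |‖T n y‖ - ‖y‖| ≤ η := by
    intro y hy
    obtain ⟨z, hz, hyz⟩ := Set.mem_iUnion₂.1 (ht (mem_sphere_zero_iff_norm.2 hy))
    rw [mem_ball_iff_norm, lt_div_iff₀ (by positivity)] at hyz
    have h1 := abs_norm_sub_norm_le (T n y) (T n z)
    rw [← map_sub] at h1
    have h2 := hT n (y - z)
    have h3 := abs_norm_sub_norm_le y z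
    have h4 := hn z hz
    rw [abs_lt] at h4
    rw [abs_le] at h1 h3 ⊢
    constructor <;> nlinarith
  intro y
  rcases eq_or_ne y 0 with rfl | hy
  · simp
  · have hy' : 0 < ‖y‖ := norm_pos_iff.2 hy
    have := hsphere (‖y‖⁻¹ • y) (by rw [norm_smul, norm_inv, norm_norm, inv_mul_cancel₀ hy'.ne'])
    rw [map_smul, norm_smul, norm_smul, ← mul_sub, abs_mul, norm_inv, norm_norm,
      abs_of_pos (inv_pos.2 hy'), inv_mul_le_iff₀ hy'] at this
    linarith

/-- A linear lift of `F` to bounded sequences, evaluated at a suitable index, is almost isometric.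
-/
lemma finitelyRepresentable_ultrapower : FinitelyRepresentable (Ultrapower X) X := by
  intro F _ ε hε
  obtain ⟨σ, hσ⟩ := (ultraNull X).mkQ.exists_rightInverse_of_surjective
    (LinearMap.range_eq_top.2 (Submodule.mkQ_surjective _))
  let L : F →L[ℝ] (ℕ →ᵇ X) := LinearMap.toContinuousLinearMap (σ ∘ₗ F.subtype)
  have hL : ∀ y : F, (Submodule.Quotient.mk (L y) : Ultrapower X) = y := fun y =>
    LinearMap.congr_fun hσ (y : Ultrapower X)
  let T : ℕ → F →ₗ[ℝ] X := fun n =>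
    { toFun := fun y => L y n
      map_add' := fun y z => by simp
      map_smul' := fun c y => by simp }
  -- With this `η`, multiplication by `(2 + ε) / 2` turns `1 - η` and `1 + η` into exactly `1` and
  -- `1 + ε`.
  have hη : 0 < ε / (2 + ε) := by positivity
  obtain ⟨n, hn⟩ := (eventually_almost_isometric (l := (hyperfilter ℕ : Filter ℕ)) T
    (C := ‖L‖ + 1) (by positivity)
    (fun n y => ((L y).norm_coe_le_norm n).trans ((L.le_opNorm y).trans (by gcongr; linarith)))
    (fun y => by simpa [T, hL] using tendsto_norm_ultra (L y)) hη).exists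
  refine ⟨((2 + ε) / 2) • T n, fun y => ?_⟩
  have h := abs_le.1 (hn y)
  rw [LinearMap.smul_apply, norm_smul, Real.norm_of_nonneg (by positivity)]
  have h1 : ε / (2 + ε) * ‖y‖ * (2 + ε) = ε * ‖y‖ := by field_simp
  constructor <;> nlinarith
end

/-! ### Bounded sign sums in a reflexive space -/

/-- In a reflexive space, the terms of a series with bounded sign sums are not bounded away
from zero. -/
lemma exists_norm_lt_of_bounded_signSums {Y : Type*} [NormedAddCommGroup Y] [NormedSpace ℝ Y]
    (hY : IsReflexiveSpace Y) {y : ℕ → Y} {C : ℝ}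
    (hC : ∀ (s : Finset ℕ) (θ : ℕ → ℤˣ), ‖∑ i ∈ s, ((θ i : ℤ) : ℝ) • y i‖ ≤ C)
    {δ : ℝ} (hδ : 0 < δ) : ∃ j, ‖y j‖ < δ := by
  classical
  have habs : ∀ (φ : Y →L[ℝ] ℝ) (s : Finset ℕ), ∑ i ∈ s, |φ (y i)| ≤ C * ‖φ‖ := by
    intro φ s
    have h := hC s fun i => if 0 ≤ φ (y i) then 1 else -1
    have h1 := (le_abs_self _).trans (φ.le_opNorm
      (∑ i ∈ s, (((if 0 ≤ φ (y i) then 1 else -1 : ℤˣ) : ℤ) : ℝ) • y i))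
    have h2 : φ (∑ i ∈ s, (((if 0 ≤ φ (y i) then 1 else -1 : ℤˣ) : ℤ) : ℝ) • y i)
        = ∑ i ∈ s, |φ (y i)| := by
      rw [map_sum]
      refine Finset.sum_congr rfl fun i _ => ?_
      split_ifs with hi
      · simp [abs_of_nonneg hi]
      · simp [abs_of_neg (not_le.1 hi)]
    rw [h2] at h1
    refine h1.trans ?_
    rw [mul_comm]
    gcongr
  have hsum : ∀ φ : Y →L[ℝ] ℝ, Summable fun i => |φ (y i)| := fun φ =>
    summable_of_sum_le (fun _ => abs_nonneg _) (habs φ)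
  let g : (ℕ → Bool) → (Y →L[ℝ] ℝ) → ℕ → ℝ := fun A φ i => if A i then φ (y i) else 0
  have hg : ∀ A φ i, ‖g A φ i‖ ≤ |φ (y i)| := by
    intro A φ i
    simp only [g]
    split_ifs <;> simp
  have hgs : ∀ A φ, Summable (g A φ) := fun A φ =>
    Summable.of_norm_bounded (hsum φ) (hg A φ)
  -- `A` codes a set of indices. The subseries over it defines an element of the bidual, and
  -- reflexivity provides its weak sum `s A`.
  have hex : ∀ A : ℕ → Bool, ∃ s : Y, ∀ φ : Y →L[ℝ] ℝ, φ s = ∑' i, g A φ i := by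
    intro A
    let Φ : (Y →L[ℝ] ℝ) →L[ℝ] ℝ := LinearMap.mkContinuous
      { toFun := fun φ => ∑' i, g A φ i
        map_add' := fun φ ψ => by
          rw [← (hgs A φ).tsum_add (hgs A ψ)]
          refine tsum_congr fun i => ?_
          simp only [g]
          split_ifs <;> simp
        map_smul' := fun c φ => by
          rw [RingHom.id_apply, smul_eq_mul, ← tsum_mul_left]
          refine tsum_congr fun i => ?_
          simp only [g]
          split_ifs <;> simp } C (fun φ => by
        refine (tsum_of_norm_bounded (hsum φ).hasSum (hg A φ)).trans ?_
        exact (hsum φ).tsum_le_of_sum_le (habs φ))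
    obtain ⟨s, hs⟩ := hY Φ
    exact ⟨s, fun φ => by rw [← NormedSpace.dual_def, hs]; rfl⟩
  choose s hs using hex
  let E : Submodule ℝ Y := (Submodule.span ℝ (Set.range y)).topologicalClosure
  have hsE : ∀ A, s A ∈ E := by
    intro A
    by_contra hA
    obtain ⟨φ, u, hu, hsu⟩ := geometric_hahn_banach_closed_point
      (E.convex) (Submodule.isClosed_topologicalClosure _) hA
    have hφ : ∀ v ∈ E, φ v = 0 := by
      intro v hv
      by_contra hne
      have := hu (((u + 1) / φ v) • v) (E.smul_mem _ hv)
      rw [map_smul, smul_eq_mul, div_mul_cancel₀ _ hne] at this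
      linarith
    have h0 : φ (s A) = 0 := by
      rw [hs]
      have : ∀ i, g A φ i = 0 := fun i => by
        have : φ (y i) = 0 := hφ _ (Submodule.le_topologicalClosure _
          (Submodule.subset_span ⟨i, rfl⟩))
        simp [g, this]
      simp [this]
    have := hu 0 E.zero_mem
    rw [map_zero] at this
    linarith
  have hsep : TopologicalSpace.IsSeparable (E : Set Y) := by
    have : TopologicalSpace.IsSeparable (Set.range y) :=
      (Set.countable_range y).isSeparable
    rw [Submodule.topologicalClosure_coe]
    exact (this.span (R := ℝ)).closure
  obtain ⟨D, hDc, hD⟩ := hsep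
  -- For each functional `φ`, the map `A ↦ φ (s A)` is a uniformly convergent series of continuous
  -- functions on the Cantor space.
  have hclosed : ∀ v : Y, IsClosed {A : ℕ → Bool | ‖s A - v‖ ≤ δ / 3} := by
    intro v
    have : {A : ℕ → Bool | ‖s A - v‖ ≤ δ / 3} =
        ⋂ φ : Y →L[ℝ] ℝ, {A | ‖∑' i, g A φ i - φ v‖ ≤ ‖φ‖ * (δ / 3)} := by
      ext A
      simp only [Set.mem_ofPred_eq, Set.mem_iInter, ← hs, ← map_sub]
      constructor
      · intro h φ
        exact (φ.le_opNorm _).trans (by gcongr)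
      · intro h
        refine NormedSpace.norm_le_dual_bound ℝ _ (by positivity) fun φ => ?_
        rw [mul_comm]
        exact h φ
    rw [this]
    refine isClosed_iInter fun φ => isClosed_le ?_ continuous_const
    refine Continuous.norm (Continuous.sub ?_ continuous_const)
    refine continuous_tsum (fun i => ?_) (hsum φ) fun i A => hg A φ i
    exact (continuous_of_discreteTopology (f := fun b : Bool => if b then φ (y i) else 0)).comp
      (continuous_apply i)
  have hcover : ⋃ v : D, {A : ℕ → Bool | ‖s A - v‖ ≤ δ / 3} = Set.univ := by
    refine Set.eq_univ_of_forall fun A => ?_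
    obtain ⟨v, hv, hvd⟩ := Metric.mem_closure_iff.1 (hD (hsE A)) (δ / 3) (by positivity)
    rw [dist_eq_norm] at hvd
    exact Set.mem_iUnion.2 ⟨⟨v, hv⟩, hvd.le⟩
  have := hDc.to_subtype
  -- By Baire, one of the countably many closed sets contains a basic open set. That set leaves some
  -- coordinate `j` free, and switching it changes `s` by exactly `y j`.
  obtain ⟨v, A, hA⟩ := nonempty_interior_of_iUnion_of_closed (fun v : D => hclosed v) hcover
  obtain ⟨U, hU, hUo, hAU⟩ := mem_interior.1 hA
  rw [isOpen_pi_iff] at hUo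
  obtain ⟨I, u, hu, hIU⟩ := hUo A hAU
  obtain ⟨j, hj⟩ := Infinite.exists_notMem_finset I
  have hmem : ∀ b, Function.update A j b ∈ U := fun b => hIU fun i hi => by
    rw [Function.update_of_ne (by rintro rfl; exact hj hi)]
    exact (hu i hi).2
  have ht := hU (hmem true)
  have hf := hU (hmem false)
  have hy : s (Function.update A j true) - s (Function.update A j false) = y j := by
    refine (SeparatingDual.eq_iff_forall_dual_eq (R := ℝ)).2 fun φ => ?_
    rw [map_sub, hs, hs, ← (hgs _ φ).tsum_sub (hgs _ φ), tsum_eq_single j]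
    · simp [g]
    · intro i hi
      simp [g, Function.update_of_ne hi]
  refine ⟨j, ?_⟩
  simp only [Set.mem_ofPred_eq] at ht hf
  calc ‖y j‖ = ‖(s (Function.update A j true) - v) - (s (Function.update A j false) - v)‖ := by
        rw [← hy]; congr 1; abel
    _ ≤ δ / 3 + δ / 3 := (norm_sub_le _ _).trans (add_le_add ht hf)
    _ < δ := by linarith

/-! ### Existence of admissible lengths -/

/-- The partial sum is the mean of two full sign sums that differ by a sign off `s`. -/
lemma norm_signSum_le_of_subset {X ι : Type*} [NormedAddCommGroup X] [NormedSpace ℝ X]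
    {s J : Finset ι} (hs : s ⊆ J) {x : ι → X} {C : ℝ}
    (h : ∀ θ : ι → ℤˣ, ‖∑ i ∈ J, ((θ i : ℤ) : ℝ) • x i‖ ≤ C) (θ : ι → ℤˣ) :
    ‖∑ i ∈ s, ((θ i : ℤ) : ℝ) • x i‖ ≤ C := by
  classical
  let θ' : ι → ℤˣ := fun i => if i ∈ s then θ i else -θ i
  have h2 : ∑ i ∈ J, ((θ i : ℤ) : ℝ) • x i + ∑ i ∈ J, ((θ' i : ℤ) : ℝ) • x i
      = (2 : ℝ) • ∑ i ∈ s, ((θ i : ℤ) : ℝ) • x i := by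
    rw [← Finset.sum_add_distrib, Finset.smul_sum]
    refine (Finset.sum_subset_zero_on_sdiff hs (fun i hi => ?_) fun i hi => ?_).symm
    · simp [θ', (Finset.mem_sdiff.1 hi).2]
    · simp [θ', hi, two_smul]
  have h3 := norm_add_le (∑ i ∈ J, ((θ i : ℤ) : ℝ) • x i) (∑ i ∈ J, ((θ' i : ℤ) : ℝ) • x i)
  rw [h2, norm_smul, Real.norm_ofNat] at h3
  linarith [h θ, h θ']

/-- If no length is admissible, then there are arbitrarily long finite sequences of vectors
that are bounded below and have uniformly bounded sign sums. -/
lemma exists_bounded_signSums_of_admissibleLengths_eq_empty {X : Type*} [NormedAddCommGroup X]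
    [NormedSpace ℝ X] {ε : ℝ} (hε : 0 < ε) (hX : admissibleLengths X ε = ∅) (d : ℕ) :
    ∃ z : ℕ → X, (∀ j < d, ε / 2 < ‖z j‖) ∧
      ∀ (s : Finset ℕ) (θ : ℕ → ℤˣ), ‖∑ i ∈ s, ((θ i : ℤ) : ℝ) • z i‖ ≤ 4 := by
  classical
  obtain ⟨K, hK⟩ := exists_bounded_signSums d
  -- Norms at most 1 with mean above `ε` leave at least `n * (ε / 2)` vectors of norm above `ε / 2`,
  -- hence at least `K` once `n ≥ N`.
  obtain ⟨N, hN⟩ := exists_nat_gt (K / (ε / 2))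
  have hnot : N + 1 ∉ admissibleLengths X ε := by simp [hX]
  simp only [admissibleLengths, Set.mem_ofPred_eq, not_and, not_forall, not_le] at hnot
  obtain ⟨n, hn, x, hx, hlt⟩ := hnot (by omega)
  rw [rademacherAverage_eq_signAverage] at hx
  let G : Finset (Fin n) := univ.filter fun k => ε / 2 < ‖x k‖
  have hn0 : (0 : ℝ) < n := by exact_mod_cast (by omega : 0 < n)
  have hG : K ≤ #G := by
    rw [inv_mul_eq_div, lt_div_iff₀ hn0] at hlt
    have h1 : ∑ k, ‖x k‖ ≤ #G + n * (ε / 2) := by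
      calc ∑ k, ‖x k‖ ≤ ∑ k, ((if ε / 2 < ‖x k‖ then 1 else 0) + ε / 2) := by
            refine Finset.sum_le_sum fun k _ => ?_
            have := (norm_le_signAverage x k).trans hx
            split_ifs with h
            · linarith
            · linarith
        _ = #G + n * (ε / 2) := by
            rw [Finset.sum_add_distrib]
            simp [G]
    rw [div_lt_iff₀ (by positivity)] at hN
    have h2 : (N : ℝ) * (ε / 2) ≤ n * (ε / 2) := by
      gcongr
      omega
    have : (K : ℝ) ≤ #G := by linarith
    exact_mod_cast this
  obtain ⟨J, hJG, hJd, hJ⟩ := hK n x hx G hG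
  let e := J.orderEmbOfFin hJd
  let z : ℕ → X := fun i => if h : i < d then x (e ⟨i, h⟩) else 0
  have hz : ∀ k : Fin d, z k = x (e k) := fun k => by simp [z]
  have hz0 : ∀ i, ¬ i < d → z i = 0 := fun i hi => by simp [z, hi]
  refine ⟨z, fun j hj => ?_, fun s θ => ?_⟩
  · rw [hz ⟨j, hj⟩]
    exact (Finset.mem_filter.1 (hJG (J.orderEmbOfFin_mem hJd _))).2
  · have hfull : ∀ θ : ℕ → ℤˣ, ‖∑ i ∈ range d, ((θ i : ℤ) : ℝ) • z i‖ ≤ 4 := by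
      intro θ
      convert hJ (Function.extend e (fun k => θ k) 1) using 2
      rw [Finset.sum_range, ← J.map_orderEmbOfFin_univ hJd, Finset.sum_map]
      refine Finset.sum_congr rfl fun k _ => ?_
      rw [hz]
      congr 3
      exact (e.injective.extend_apply (fun k : Fin d => θ k) 1 k).symm
    have hs : ∑ i ∈ s, ((θ i : ℤ) : ℝ) • z i
        = ∑ i ∈ s.filter (· < d), ((θ i : ℤ) : ℝ) • z i := by
      refine (Finset.sum_filter_of_ne fun i _ h => ?_).symm
      by_contra hi
      simp [hz0 i hi] at h
    rw [hs]
    exact norm_signSum_le_of_subset (fun i hi => by simpa using (Finset.mem_filter.1 hi).2)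
      hfull θ

lemma admissibleLengths_nonempty {X : Type*} [NormedAddCommGroup X] [NormedSpace ℝ X]
    [CompleteSpace X] (hX : SuperReflexive X) {ε : ℝ} (hε : 0 < ε) :
    (admissibleLengths X ε).Nonempty := by
  by_contra hne
  choose z hz hz4 using fun d => exists_bounded_signSums_of_admissibleLengths_eq_empty hε
    (Set.not_nonempty_iff_eq_empty.1 hne) d
  let g : ℕ → ℕ →ᵇ X := fun j => BoundedContinuousFunction.ofNormedAddCommGroupDiscrete
    (fun d => z d j) 4 (fun d => by simpa using hz4 d {j} 1)
  have hg : ∀ j d, g j d = z d j := fun _ _ => rfl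
  obtain ⟨j, hj⟩ := exists_norm_lt_of_bounded_signSums
    (hX (Ultrapower X) finitelyRepresentable_ultrapower)
    (y := fun j => Submodule.Quotient.mk (g j)) (C := 4) (fun s θ => by
      have : ∑ i ∈ s, ((θ i : ℤ) : ℝ) • (Submodule.Quotient.mk (g i) : Ultrapower X)
          = Submodule.Quotient.mk (∑ i ∈ s, ((θ i : ℤ) : ℝ) • g i) := by
        simp only [← Submodule.mkQ_apply, map_sum, map_smul]
      rw [this]
      refine (Submodule.Quotient.norm_mk_le _ _).trans ?_
      refine (BoundedContinuousFunction.norm_le (by norm_num)).2 fun d => ?_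
      simpa [BoundedContinuousFunction.sum_apply, hg] using hz4 d s θ)
    (half_pos hε)
  -- The `j`-th vector of the `d`-th family is bounded below only for `d > j`, which a free
  -- ultrafilter does not notice.
  refine hj.not_ge (ge_of_tendsto (tendsto_norm_ultra (g j)) ?_)
  filter_upwards [Nat.hyperfilter_le_atTop (eventually_gt_atTop j)] with d hd
  exact (hz d j hd).le

lemma isLeast_frakQ {X : Type*} [NormedAddCommGroup X] [NormedSpace ℝ X]
    [CompleteSpace X] (hX : SuperReflexive X) {ε : ℝ} (hε : 0 < ε) :
    IsLeast (admissibleLengths X ε) (frakQ X ε) :=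
  ⟨Nat.sInf_mem (admissibleLengths_nonempty hX hε), fun _ h => Nat.sInf_le h⟩

/-! ### The generalized cotype -/

section

variable {X : Type*} [NormedAddCommGroup X] [NormedSpace ℝ X]

lemma frakQ_le_of_le {s t : ℝ} (hs : frakQ X s ∈ admissibleLengths X s) (hst : s ≤ t) :
    frakQ X t ≤ frakQ X s :=
  Nat.sInf_le ⟨hs.1, fun n hn x hx => (hs.2 n hn x hx).trans hst⟩

lemma phiAlpha_nonneg (α t : ℝ) : 0 ≤ phiAlpha X α t := by
  unfold phiAlpha
  split_ifs <;> positivity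

lemma phiAlpha_monotoneOn (hQ : ∀ ε : ℝ, 0 < ε → frakQ X ε ∈ admissibleLengths X ε)
    {α : ℝ} (hα : 0 ≤ α) : MonotoneOn (phiAlpha X α) (Set.Ico 0 1) := by
  intro s hs t ht hst
  rcases hs.1.eq_or_lt with rfl | hs0
  · exact le_of_eq_of_le (if_pos rfl) (phiAlpha_nonneg α t)
  · have ht0 := hs0.trans_le hst
    rw [phiAlpha, phiAlpha, if_neg hs0.ne', if_neg ht0.ne']
    have hlogs := Real.log_neg hs0 hs.2
    have hlogt := Real.log_neg ht0 ht.2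
    have hlog := Real.log_le_log hs0 hst
    have hQt : (0 : ℝ) < frakQ X t := by exact_mod_cast (hQ t ht0).1
    have hQst : (frakQ X t : ℝ) ≤ frakQ X s := by exact_mod_cast frakQ_le_of_le (hQ s hs0) hst
    rw [one_div, one_div, Real.log_inv, Real.log_inv, abs_neg, abs_neg, abs_of_neg hlogs,
      abs_of_neg hlogt]
    exact mul_le_mul
      (Real.rpow_le_rpow_of_nonpos (by linarith) (by linarith) (by linarith))
      (inv_anti₀ hQt hQst) (by positivity) (Real.rpow_nonneg (by linarith) _)

/-- Otherwise the doubled subfamily over `B` would have admissible length and sign average at most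
1, yet mean norm above `t`. -/
lemma card_lt_frakQ {t : ℝ} (hQ : frakQ X t ∈ admissibleLengths X t) {n : ℕ} {x : Fin n → X}
    (hx : rademacherAverage x ≤ 1 / 2) {B : Finset (Fin n)} (hB : ∀ k ∈ B, t < 2 * ‖x k‖) :
    #B < frakQ X t := by
  by_contra! hcon
  have hB0 : 0 < #B := hQ.1.trans hcon
  let e := (B.orderEmbOfFin rfl).toEmbedding
  have h := hQ.2 #B hcon (fun i => (2 : ℝ) • x (e i)) (by
    rw [rademacherAverage_eq_signAverage] at hx ⊢
    rw [signAverage_smul 2 fun i => x (e i), abs_two]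
    have := signAverage_comp_embedding_le e x
    change signAverage (fun i => x (e i)) ≤ _ at this
    linarith)
  have hlt : ∑ _i : Fin #B, t < ∑ i, ‖(2 : ℝ) • x (e i)‖ := by
    have : Nonempty (Fin #B) := ⟨⟨0, hB0⟩⟩
    refine Finset.sum_lt_sum_of_nonempty Finset.univ_nonempty fun i _ => ?_
    rw [norm_smul, Real.norm_ofNat]
    exact hB _ (B.orderEmbOfFin_mem rfl i)
  rw [inv_mul_le_iff₀ (by exact_mod_cast hB0)] at h
  simp only [Finset.sum_const, Finset.card_univ, Fintype.card_fin, nsmul_eq_mul] at hlt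
  linarith

lemma isGeneralizedCotypeOn_phiAlpha
    (hQ : ∀ ε : ℝ, 0 < ε → frakQ X ε ∈ admissibleLengths X ε) {α : ℝ} (hα : 1 < α) :
    IsGeneralizedCotypeOn X (Set.Ico 0 1) (phiAlpha X α) := by
  classical
  have hlog2 := Real.log_pos one_lt_two
  -- This is the logarithmic factor of `phiAlpha` at `2⁻¹ ^ (j + 1)`, an upper bound for the norms
  -- in level `j`; the shift avoids the zero of the logarithm at 1.
  let c : ℕ → ℝ := fun j => (((j + 1 : ℕ) : ℝ) * Real.log 2) ^ (-α)
  have hc : ∀ j, 0 < c j := fun j => by positivity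
  have hcs : Summable c := by
    have h := ((summable_nat_add_iff 1).2 (Real.summable_nat_rpow.2 (neg_lt_neg hα))).mul_right
      (Real.log 2 ^ (-α))
    refine h.congr fun j => ?_
    exact (Real.mul_rpow (by positivity) hlog2.le).symm
  have hmono := phiAlpha_monotoneOn hQ (zero_le_one.trans hα.le)
  refine ⟨fun t _ => phiAlpha_nonneg α t, hmono,
    1 / 2, ∑' j, c j, by norm_num, hcs.tsum_pos (fun j => (hc j).le) 0 (hc 0),
    fun n x hx => ?_⟩
  have hle : ∀ k, ‖x k‖ ≤ 1 / 2 := fun k =>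
    (norm_le_signAverage x k).trans (by rwa [← rademacherAverage_eq_signAverage])
  have hmem : ∀ k, ‖x k‖ ∈ Set.Ico (0 : ℝ) 1 := fun k =>
    ⟨norm_nonneg _, (hle k).trans_lt (by norm_num)⟩
  refine ⟨hmem, ?_⟩
  -- Zero vectors get the arbitrary level 0; they are excluded from `S` and contribute nothing.
  have hlev : ∀ k, ∃ j : ℕ, x k ≠ 0 → (1 / 2 : ℝ) ^ (j + 1) < 2 * ‖x k‖ ∧
      2 * ‖x k‖ ≤ (1 / 2) ^ j := by
    intro k
    by_cases h : x k = 0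
    · exact ⟨0, fun h' => absurd h h'⟩
    · have := norm_pos_iff.2 h
      obtain ⟨j, hj⟩ := exists_nat_pow_near_of_lt_one (x := 2 * ‖x k‖) (y := 1 / 2)
        (by positivity) (by linarith [hle k]) (by norm_num) (by norm_num)
      exact ⟨j, fun _ => hj⟩
  choose lev hlev using hlev
  let S : Finset (Fin n) := univ.filter fun k => x k ≠ 0
  have hfiber : ∀ j, ∑ k ∈ S.filter (lev · = j), phiAlpha X α ‖x k‖ ≤ c j := by
    intro j
    have hpow0 : (0 : ℝ) < (1 / 2) ^ (j + 1) := by positivity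
    have hpow1 : (1 / 2 : ℝ) ^ (j + 1) < 1 := pow_lt_one₀ (by norm_num) (by norm_num) (by omega)
    have hval : phiAlpha X α ((1 / 2) ^ (j + 1))
        = c j * ((frakQ X ((1 / 2) ^ (j + 1)) : ℕ) : ℝ)⁻¹ := by
      rw [phiAlpha, if_neg hpow0.ne']
      congr 2
      rw [one_div, ← inv_pow, one_div, inv_inv, Real.log_pow, abs_of_pos (by positivity)]
    have hcard := card_lt_frakQ (hQ _ hpow0) hx (B := S.filter (lev · = j)) fun k hk => by
      obtain ⟨hkS, rfl⟩ := Finset.mem_filter.1 hk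
      exact (hlev k (Finset.mem_filter.1 hkS).2).1
    have hQ0 : (0 : ℝ) < frakQ X ((1 / 2) ^ (j + 1)) := by exact_mod_cast (hQ _ hpow0).1
    calc ∑ k ∈ S.filter (lev · = j), phiAlpha X α ‖x k‖
        ≤ ∑ k ∈ S.filter (lev · = j), phiAlpha X α ((1 / 2) ^ (j + 1)) := by
          refine Finset.sum_le_sum fun k hk => hmono (hmem k) ⟨hpow0.le, hpow1⟩ ?_
          obtain ⟨hkS, rfl⟩ := Finset.mem_filter.1 hk
          have := (hlev k (Finset.mem_filter.1 hkS).2).2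
          rw [pow_succ]
          linarith
      _ = #(S.filter (lev · = j)) * (c j * ((frakQ X ((1 / 2) ^ (j + 1)) : ℕ) : ℝ)⁻¹) := by
          rw [Finset.sum_const, nsmul_eq_mul, hval]
      _ ≤ frakQ X ((1 / 2) ^ (j + 1)) * (c j * ((frakQ X ((1 / 2) ^ (j + 1)) : ℕ) : ℝ)⁻¹) := by
          have := (hc j).le
          gcongr
      _ = c j := by field_simp
  calc ∑ k, phiAlpha X α ‖x k‖ = ∑ k ∈ S, phiAlpha X α ‖x k‖ := by
        refine (Finset.sum_filter_of_ne fun k _ h => ?_).symm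
        intro hk
        rw [hk, norm_zero] at h
        exact h (if_pos rfl)
    _ = ∑ j ∈ S.image lev, ∑ k ∈ S.filter (lev · = j), phiAlpha X α ‖x k‖ :=
        (Finset.sum_fiberwise_of_maps_to (fun k hk => Finset.mem_image_of_mem lev hk) _).symm
    _ ≤ ∑ j ∈ S.image lev, c j := Finset.sum_le_sum fun j _ => hfiber j
    _ ≤ ∑' j, c j := hcs.sum_le_tsum _ fun j _ => (hc j).le

end

theorem proposition5p1 (X : Type*) [NormedAddCommGroup X] [NormedSpace ℝ X]
    [CompleteSpace X] (hX : SuperReflexive X) :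
    (∀ ε : ℝ, 0 < ε → IsLeast (admissibleLengths X ε) (frakQ X ε)) ∧
      ∀ α : ℝ, 1 < α → IsGeneralizedCotypeOn X (Set.Ico 0 1) (phiAlpha X α) :=
  ⟨fun _ hε => isLeast_frakQ hX hε,
    fun _ hα => isGeneralizedCotypeOn_phiAlpha (fun _ hε => (isLeast_frakQ hX hε).1) hα⟩
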